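/- Let $G=(V,E,C)$ be a finite acyclic directed network with integer edge capacities $C(e)\in\mathbb N$ (bits per unit of time), two distinct source nodes $s_x,s_y\in V$ and a set $T\subset V\setminus\{s_x,s_y\}$ of terminals. Let $\rho(A;t)$ be the value of the min-cut from a set $A$ of nodes to $t$, and $\rho_G(A)=\min_{t\in T}\rho(A;t)$. Let $p_{X,Y}$ be a joint law on a product of finite alphabets $\mathcal X\times\mathcal Y$; entropies are in bits. The Gács–Körner common information $K=K_{X,Y}$ is the connected component that contains $X$ (and $Y$) in the bipartite graph on $\mathcal X\sqcup\mathcal Y$ in which $x$ and $y$ are joined iff $p_{X,Y}(x,y)>0$. The multicast problem $(G,p_{X,Y})$ is *feasible* if $$H(X|Y)\le\rho_G(s_x),\qquad H(Y|X)\le\rho_G(s_y),\qquad H(X,Y)\le\rho_G(s_x,s_y).$$ The *GK-separation conditions* are $$H(X|K)\le\rho_G(s_x),\qquad H(Y|K)\le\rho_G(s_y),\qquad H(X|K)+H(Y|K)+H(K)\le\rho_G(s_x,s_y).$$ The *expansion* $\tilde G$ of $G$ has three further nodes $s_{X'},s_{Y'},s_K$ and edges of infinite capacity $s_{X'}\to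 s_x$, $s_{Y'}\to s_y$, $s_K\to s_x$, $s_K\to s_y$; $G^N$ is $G$ with all capacities multiplied by $N$. The problem is *feasible by source decomposition* if for every $\varepsilon>0$ and all sufficiently large $n$ there are an $N\le(1+\varepsilon)n$ and separate encoders of $k^n$, $x^n$ and $y^n$ into at most $n(H(K)+\varepsilon)$, $n(H(X|K)+\varepsilon)$ and $n(H(Y|K)+\varepsilon)$ bits, with decoders that recover $k^n$ from its code word, and $x^n$ (respectively $y^n$) from $k^n$ and its code word, for $n$ i.i.d. outcomes of $p_{X,Y}$ with total error probability at most $\varepsilon$, such that some network code on the expansion of $G^N$ multicasts without error arbitrary bit strings of these three lengths, generated at $s_K$, $s_{X'}$, $s_{Y'}$, to all terminals. **Statement.** Suppose $H(K_{X,Y})=I(X;Y)$. If $(G,p_{X,Y})$ is feasible, then it is feasible by source decomposition, and $\tilde G$ satisfies the min-cut conditions for independent sources of rates $H(X|K)$, $H(Y|K)$, $H(K)$ at $s_{X'},s_{Y'},s_K$: for every nonempty set of these sources, the sum of their rates is at most $\rho_{\tilde G}$ of the set of their nodes. Moreover the GK-separation conditions coincide with the feasibility conditions: $H(X|K)=H(X|Y)$,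 $H(Y|K)=H(Y|X)$ and $H(X|K)+H(Y|K)+H(K)=H(X,Y)$, so one set of conditions holds if and only if the other does. -/

import Mathlib

open scoped Classical ENNReal

namespace GKSeparation

noncomputable section

/-! ### Entropies of functions of a finite random outcome, in bits -/

section Entropy

variable {α β γ : Type*} [Fintype α] [Fintype β] [Fintype γ]

/-- `P(f = b)` when the outcome `a` has law `p`. -/
def prob (p : PMF α) (f : α → β) (b : β) : ℝ :=
  ∑ a with f a = b, (p a).toReal

/-- `H(f) = ∑ P(f = b) log₂ (1 / P(f = b))`. -/
def entropy (p : PMF α) (f : α → β) : ℝ :=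
  ∑ b, prob p f b * Real.logb 2 (1 / prob p f b)

/-- `H(f | g) = ∑ P(f = b, g = c) log₂ (1 / P(f = b | g = c))`. -/
def condEntropy (p : PMF α) (f : α → β) (g : α → γ) : ℝ :=
  ∑ b, ∑ c, prob p (fun a => (f a, g a)) (b, c) *
    Real.logb 2 (prob p g c / prob p (fun a => (f a, g a)) (b, c))

/-- `I(f ; g) = ∑ P(f = b, g = c) log₂ (P(f = b, g = c) / (P(f = b) P(g = c)))`. -/
def mutualInfo (p : PMF α) (f : α → β) (g : α → γ) : ℝ :=
  ∑ b, ∑ c, prob p (fun a => (f a, g a)) (b, c) *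
    Real.logb 2 (prob p (fun a => (f a, g a)) (b, c) / (prob p f b * prob p g c))

/-- The probability of the event `A` for `n` independent outcomes of law `p`. -/
def iidProb (p : PMF α) (n : ℕ) (A : Set (Fin n → α)) : ℝ :=
  ∑ z with z ∈ A, ∏ i, (p (z i)).toReal

end Entropy

/-! ### Gács–Körner common information -/

section CommonInformation

variable {𝒳 𝒴 : Type*}

/-- The bipartite representation of `p`: a node for each letter of the two (disjoint) alphabets,
and an edge between `x` and `y` exactly when `p (x, y) > 0`. -/
def bipartite (p : PMF (𝒳 × 𝒴)) : SimpleGraph (𝒳 ⊕ 𝒴) :=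
  SimpleGraph.fromRel fun u v => ∃ x y, u = Sum.inl x ∧ v = Sum.inr y ∧ p (x, y) ≠ 0

/-- The values of the common information: the connected components of the bipartite graph. -/
abbrev Common (p : PMF (𝒳 × 𝒴)) : Type _ := (bipartite p).ConnectedComponent

instance instFintypeCommon [Fintype 𝒳] [Fintype 𝒴] (p : PMF (𝒳 × 𝒴)) : Fintype (Common p) := Fintype.ofFinite _

/-- The common information `K`: the component that contains `x`. On the support of `p`
this is also the component that contains `y`. -/
def commonInfo (p : PMF (𝒳 × 𝒴)) (z : 𝒳 × 𝒴) : Common p :=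
  (bipartite p).connectedComponentMk (Sum.inl z.1)

theorem commonInfo_eq_right (p : PMF (𝒳 × 𝒴)) (z : 𝒳 × 𝒴) (hz : p z ≠ 0) :
    commonInfo p z = (bipartite p).connectedComponentMk (Sum.inr z.2) := by
  refine SimpleGraph.ConnectedComponent.sound (SimpleGraph.Adj.reachable ?_)
  rw [bipartite, SimpleGraph.fromRel_adj]
  exact ⟨by simp, Or.inl ⟨z.1, z.2, rfl, rfl, hz⟩⟩

end CommonInformation

/-! ### Networks, cuts and network codes -/

/-- A directed (multi)graph with edge capacities in bits per unit of time;
the value `⊤` is an infinite capacity. -/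
structure Network (V E : Type*) where
  src : E → V
  tgt : E → V
  cap : E → ℕ∞

namespace Network

variable {V E ι : Type*} [Fintype V] [Fintype E]

/-- There is no directed cycle. -/
def Acyclic (G : Network V E) : Prop :=
  ∀ v, ¬ Relation.TransGen (fun u w => ∃ e, G.src e = u ∧ G.tgt e = w) v v

/-- The `n`-delayed network: all capacities are multiplied by `n`. -/
def delayed (G : Network V E) (n : ℕ) : Network V E where
  src := G.src
  tgt := G.tgt
  cap e := n * G.cap e

/-- The total capacity of the edges that leave `S`. -/
def cutCap (G : Network V E) (S : Set V) : ℕ∞ :=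
  ∑ e with G.src e ∈ S ∧ G.tgt e ∉ S, G.cap e

/-- The value `ρ(A; t)` of the min-cut from the set of nodes `A` to the node `t`. -/
def minCut (G : Network V E) (A : Set V) (t : V) : ℕ∞ :=
  ⨅ (S : Set V) (_ : A ⊆ S ∧ t ∉ S), G.cutCap S

/-- The capacity function `ρ_G(A) = min_{t ∈ T} ρ(A; t)`. -/
def capFun (G : Network V E) (T : Finset V) (A : Set V) : ℕ∞ :=
  ⨅ t ∈ T, G.minCut A t

/-- The real rate `h` is at most the capacity `ρ_G(A)`. -/
def RateLE (G : Network V E) (T : Finset V) (h : ℝ) (A : Set V) : Prop :=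
  (h : EReal) ≤ (((G.capFun T A : ℕ∞) : ℝ≥0∞) : EReal)

/-- The min-cut conditions for independent sources of entropies `h i` at the nodes `loc i`. -/
def IndepFeasible (G : Network V E) (loc : ι → V) (T : Finset V) (h : ι → ℝ) : Prop :=
  ∀ A : Finset ι, A.Nonempty → G.RateLE T (∑ i ∈ A, h i) (loc '' (A : Set ι))

/-- `φ e m` is the symbol on the edge `e` when the tuple of source messages is `m`.
The tuples `m` and `m'` look the same at `v`: the messages generated at `v` agree,
and so do the symbols on all the edges that enter `v`. -/
def SameView {M : ι → Type*} (G : Network V E) (loc : ι → V) (φ : E → (∀ i, M i) → ℕ)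
    (v : V) (m m' : ∀ i, M i) : Prop :=
  (∀ i, loc i = v → m i = m' i) ∧ ∀ e, G.tgt e = v → φ e m = φ e m'

/-- The network supports, without error, the multicast to all the terminals in `T` of arbitrary
messages of `r i` bits generated at the nodes `loc i`: there is a network code in which
an edge of capacity `c` carries at most `c` bits, the symbol on an edge is a function of what is
available at its tail, and each terminal can tell all the message tuples apart. -/
def Supports (G : Network V E) (loc : ι → V) (T : Finset V) (r : ι → ℕ) : Prop :=
  ∃ φ : E → (∀ i, Fin (2 ^ r i)) → ℕ,
    (∀ e m, ∀ c : ℕ, G.cap e = c → φ e m < 2 ^ c) ∧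
    (∀ e m m', G.SameView loc φ (G.src e) m m' → φ e m = φ e m') ∧
    (∀ t ∈ T, ∀ m m', G.SameView loc φ t m m' → m = m')

end Network

/-! ### The expanded network with latent sources -/

/-- The latent sources `X'`, `Y'` and `K`. -/
inductive Latent
  | X'
  | Y'
  | K
  deriving DecidableEq

/-- The added edges `s_{X'} → s_X`, `s_{Y'} → s_Y`, `s_K → s_X` and `s_K → s_Y`. -/
inductive LatentEdge
  | X'
  | Y'
  | KX
  | KY
  deriving DecidableEq

instance instFintypeLatentEdge : Fintype LatentEdge where
  elems := {.X', .Y', .KX, .KY}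
  complete e := by cases e <;> simp

/-- The expanded network: three nodes for the latent sources, linked to `sx` and `sy`
by edges of infinite capacity. -/
def Network.expand {V E : Type*} (G : Network V E) (sx sy : V) :
    Network (V ⊕ Latent) (E ⊕ LatentEdge) where
  src
    | .inl e => .inl (G.src e)
    | .inr .X' => .inr .X'
    | .inr .Y' => .inr .Y'
    | .inr .KX => .inr .K
    | .inr .KY => .inr .K
  tgt
    | .inl e => .inl (G.tgt e)
    | .inr .X' => .inl sx
    | .inr .Y' => .inl sy
    | .inr .KX => .inl sx
    | .inr .KY => .inl sy
  cap
    | .inl e => G.cap e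
    | .inr _ => ⊤

section Multicast

variable {V E 𝒳 𝒴 : Type*} [Fintype V] [Fintype E] [Fintype 𝒳] [Fintype 𝒴]

/-- The two-source multicast problem `(G, p)` with `X` at `sx` and `Y` at `sy` is feasible:
`H(X|Y) ≤ ρ_G(sx)`, `H(Y|X) ≤ ρ_G(sy)` and `H(X,Y) ≤ ρ_G(sx, sy)`. -/
def Feasible (G : Network V E) (sx sy : V) (T : Finset V) (p : PMF (𝒳 × 𝒴)) : Prop :=
  G.RateLE T (condEntropy p Prod.fst Prod.snd) {sx} ∧
  G.RateLE T (condEntropy p Prod.snd Prod.fst) {sy} ∧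
  G.RateLE T (entropy p id) {sx, sy}

/-- The conditions `H(X|K) ≤ ρ_G(sx)`, `H(Y|K) ≤ ρ_G(sy)` and
`H(X|K) + H(Y|K) + H(K) ≤ ρ_G(sx, sy)`. -/
def GKConditions (G : Network V E) (sx sy : V) (T : Finset V) (p : PMF (𝒳 × 𝒴)) : Prop :=
  G.RateLE T (condEntropy p Prod.fst (commonInfo p)) {sx} ∧
  G.RateLE T (condEntropy p Prod.snd (commonInfo p)) {sy} ∧
  G.RateLE T (condEntropy p Prod.fst (commonInfo p) + condEntropy p Prod.snd (commonInfo p)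
    + entropy p (commonInfo p)) {sx, sy}

/-- The rates of the latent sources: `H(X|K)`, `H(Y|K)` and `H(K)`. -/
def latentRate (p : PMF (𝒳 × 𝒴)) : Latent → ℝ
  | .X' => condEntropy p Prod.fst (commonInfo p)
  | .Y' => condEntropy p Prod.snd (commonInfo p)
  | .K => entropy p (commonInfo p)

/-- A source code for the decomposition of blocks of length `n`: `k^n`, `x^n` and `y^n` are encoded
separately into `r K`, `r X'` and `r Y'` bits; `k^n` is decoded from its own code word, and
`x^n` (and `y^n`) from `k^n` and its own code word, with error probability at most `ε`. -/
def DecompositionCode (p : PMF (𝒳 × 𝒴)) (n : ℕ) (r : Latent → ℕ) (ε : ℝ) : Prop :=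
  ∃ (encK : (Fin n → Common p) → Fin (2 ^ r .K))
    (encX : (Fin n → 𝒳) → Fin (2 ^ r .X'))
    (encY : (Fin n → 𝒴) → Fin (2 ^ r .Y'))
    (decK : Fin (2 ^ r .K) → Fin n → Common p)
    (decX : (Fin n → Common p) → Fin (2 ^ r .X') → Fin n → 𝒳)
    (decY : (Fin n → Common p) → Fin (2 ^ r .Y') → Fin n → 𝒴),
    iidProb p n {z | ¬ (
      let k := fun i => commonInfo p (z i)
      let x := fun i => (z i).1
      let y := fun i => (z i).2
      let k' := decK (encK k)
      k' = k ∧ decX k' (encX x) = x ∧ decY k' (encY y) = y)} ≤ ε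

/-- The problem `(G, p)` is feasible by source decomposition: for each `ε > 0` and all large `n`,
blocks of length `n` can be encoded separately at the rates `H(X|K)`, `H(Y|K)` and `H(K)`
(up to `ε`), with error probability at most `ε`, so that the expansion of the `N`-delayed network,
for some `N ≤ (1 + ε) n`, supports the three code words as if they were independent. -/
def FeasibleByDecomposition (G : Network V E) (sx sy : V) (T : Finset V)
    (p : PMF (𝒳 × 𝒴)) : Prop :=
  ∀ ε : ℝ, 0 < ε → ∃ n₀ : ℕ, ∀ n ≥ n₀, ∃ (N : ℕ) (r : Latent → ℕ),
    (N : ℝ) ≤ (1 + ε) * n ∧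
    (∀ j, (r j : ℝ) ≤ n * (latentRate p j + ε)) ∧
    DecompositionCode p n r ε ∧
    ((G.delayed N).expand sx sy).Supports Sum.inr (T.map Function.Embedding.inl) r

end Multicast

end

end GKSeparation

/-!
The common information `K` is a function of `X`, and almost surely a function of `Y`, so
`H(X|K) = H(X) - H(K)` and `H(Y|K) = H(Y) - H(K)`. When `H(K) = I(X;Y)` these are `H(X|Y)` and
`H(Y|X)`, and the three rates add up to `H(X,Y)`. Hence the two sets of conditions coincide.

A cut of the expansion has infinite capacity unless it keeps `sx` and `sy` on the side of
the latent sources that are linked to them. So the seven min-cut conditions on the expansion reduce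
to three conditions on the cuts of `G`, which are the GK-separation conditions
(`ceil_sum_latentRate_le_cutCap`, `indepFeasible_expand`).

For feasibility by decomposition there is a source coding part and a network coding part.

Source coding: the encoder of `x^n` can compute `k^n`, and so can the encoder of `y^n`, up to a null
event. Each sends the index of its sequence among those with conditional probability
at least `2 ^ (-r)` given `k^n`. There are at most `2 ^ r` of these (`card_condTypical_le`), and
Chernoff's bound shows that the actual sequence is one of them with high probability, as soon as
`r` exceeds `n` times the entropy by a linear term (`eventually_iidProb_codeLength_lt_le`). A
source of rate `0` is determined by the side information and gets no bits.

Network coding: the factor `1 + ε` in the delay gives every relevant cut an excess that grows with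
`n` over the number of bits to be sent. With such an excess a uniformly random linear code over
`𝔽₂` works, by a union bound and without max-flow arguments. By linearity it is enough that
no terminal sees only zeros when the message `d` is nonzero. If one does, then the set `S` of the
nodes that see something nonzero is a cut, and for fixed `d` and `S` the probability of this is
at most `2 ^ (-cut S)` (`card_linCode_isRun_le`). Since `cut S` exceeds the number of bits of the
nonzero messages in `d` by a large constant, the sum over `d` and `S` is less than `1`
(`exists_linCode`).
-/

namespace GKSeparation

/-! ### Entropies as expectations -/

section Entropy

variable {α β γ : Type*}

theorem toReal_pos_of_ne_zero (p : PMF α) {a : α} (ha : p a ≠ 0) : 0 < (p a).toReal :=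
  ENNReal.toReal_pos ha (p.apply_ne_top a)

variable [Fintype α]

theorem sum_toReal_eq_one (p : PMF α) : ∑ a, (p a).toReal = 1 := by
  rw [← ENNReal.toReal_sum fun a _ => p.apply_ne_top a,
    ← tsum_fintype (L := SummationFilter.unconditional α), p.tsum_coe, ENNReal.toReal_one]

theorem prob_nonneg (p : PMF α) (f : α → β) (b : β) : 0 ≤ prob p f b :=
  Finset.sum_nonneg fun _ _ => ENNReal.toReal_nonneg

theorem toReal_le_prob (p : PMF α) (f : α → β) (a : α) : (p a).toReal ≤ prob p f (f a) :=
  Finset.single_le_sum (f := fun a => (p a).toReal) (fun _ _ => ENNReal.toReal_nonneg)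
    (by simp)

theorem prob_pos (p : PMF α) (f : α → β) {a : α} (ha : p a ≠ 0) : 0 < prob p f (f a) :=
  (toReal_pos_of_ne_zero p ha).trans_le (toReal_le_prob p f a)

theorem prob_pair_le (p : PMF α) (f : α → β) (g : α → γ) (b : β) (c : γ) :
    prob p (fun a => (f a, g a)) (b, c) ≤ prob p g c := by
  refine Finset.sum_le_sum_of_subset_of_nonneg (fun a => ?_) fun _ _ _ => ENNReal.toReal_nonneg
  simp +contextual

theorem toReal_mul_logb_nonneg (p : PMF α) (f : α → β) (g : α → γ) (a : α) :
    0 ≤ (p a).toReal *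
      Real.logb 2 (prob p g (g a) / prob p (fun a => (f a, g a)) (f a, g a)) := by
  by_cases ha : p a = 0
  · simp [ha]
  · exact mul_nonneg ENNReal.toReal_nonneg (Real.logb_nonneg one_lt_two
      ((one_le_div (prob_pos p (fun a => (f a, g a)) ha)).2 (prob_pair_le p f g _ _)))

variable [Fintype β]

/-- The expectation of `F ∘ f`, computed from the law of `f`. -/
theorem sum_prob_mul (p : PMF α) (f : α → β) (F : β → ℝ) :
    ∑ b, prob p f b * F b = ∑ a, (p a).toReal * F (f a) := by
  simp only [prob, Finset.sum_mul, Finset.sum_filter]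
  rw [Finset.sum_comm]
  refine Finset.sum_congr rfl fun a _ => ?_
  simp [ite_mul]

theorem sum_prob_pair (p : PMF α) (f : α → β) (g : α → γ) (c : γ) :
    ∑ b, prob p (fun a => (f a, g a)) (b, c) = prob p g c := by
  simp only [prob, Finset.sum_filter, Prod.mk.injEq]
  rw [Finset.sum_comm]
  refine Finset.sum_congr rfl fun a _ => ?_
  by_cases h : g a = c <;> simp [h]

variable [Fintype γ]

theorem sum_prob_mul_prod (p : PMF α) (f : α → β) (g : α → γ) (F : β → γ → ℝ) :
    ∑ b, ∑ c, prob p (fun a => (f a, g a)) (b, c) * F b c =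
      ∑ a, (p a).toReal * F (f a) (g a) := by
  rw [← Fintype.sum_prod_type' (f := fun b c => prob p (fun a => (f a, g a)) (b, c) * F b c)]
  exact sum_prob_mul p (fun a => (f a, g a)) fun x => F x.1 x.2

theorem sum_prob (p : PMF α) (f : α → β) : ∑ b, prob p f b = 1 := by
  simpa [sum_toReal_eq_one] using sum_prob_mul p f fun _ => 1

/-- Two expectations agree if the integrands agree on the support. -/
theorem sum_toReal_mul_congr (p : PMF α) {F F' : α → ℝ} (h : ∀ a, p a ≠ 0 → F a = F' a) :
    ∑ a, (p a).toReal * F a = ∑ a, (p a).toReal * F' a := by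
  refine Finset.sum_congr rfl fun a _ => ?_
  by_cases ha : p a = 0
  · simp [ha]
  · rw [h a ha]

theorem entropy_eq_sum (p : PMF α) (f : α → β) :
    entropy p f = ∑ a, (p a).toReal * -Real.logb 2 (prob p f (f a)) := by
  rw [entropy, sum_prob_mul p f fun b => Real.logb 2 (1 / prob p f b)]
  simp

theorem condEntropy_eq_sum (p : PMF α) (f : α → β) (g : α → γ) :
    condEntropy p f g = ∑ a, (p a).toReal *
      Real.logb 2 (prob p g (g a) / prob p (fun a => (f a, g a)) (f a, g a)) :=
  sum_prob_mul_prod p f g fun b c =>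
    Real.logb 2 (prob p g c / prob p (fun a => (f a, g a)) (b, c))

/-- `H(f | g) = H(f, g) - H(g)`. -/
theorem condEntropy_eq_sub (p : PMF α) (f : α → β) (g : α → γ) :
    condEntropy p f g = entropy p (fun a => (f a, g a)) - entropy p g := by
  rw [condEntropy_eq_sum, entropy_eq_sum, entropy_eq_sum, ← Finset.sum_sub_distrib]
  simp only [← mul_sub]
  refine sum_toReal_mul_congr p fun a ha => ?_
  rw [Real.logb_div (prob_pos p g ha).ne' (prob_pos p (fun a => (f a, g a)) ha).ne']
  ring

/-- `I(f ; g) = H(f) + H(g) - H(f, g)`. -/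
theorem mutualInfo_eq (p : PMF α) (f : α → β) (g : α → γ) :
    mutualInfo p f g = entropy p f + entropy p g - entropy p (fun a => (f a, g a)) := by
  rw [mutualInfo, sum_prob_mul_prod p f g fun b c =>
    Real.logb 2 (prob p (fun a => (f a, g a)) (b, c) / (prob p f b * prob p g c)),
    entropy_eq_sum, entropy_eq_sum, entropy_eq_sum, ← Finset.sum_add_distrib,
    ← Finset.sum_sub_distrib]
  simp only [← mul_sub, ← mul_add]
  refine sum_toReal_mul_congr p fun a ha => ?_
  have h1 := (prob_pos p f ha).ne'
  have h2 := (prob_pos p g ha).ne'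
  rw [Real.logb_div (prob_pos p (fun a => (f a, g a)) ha).ne' (mul_ne_zero h1 h2),
    Real.logb_mul h1 h2]
  ring

/-- Two functions that generate the same partition of the support have the same entropy. -/
theorem entropy_congr (p : PMF α) (f : α → β) (g : α → γ)
    (h : ∀ a a', p a ≠ 0 → p a' ≠ 0 → (f a = f a' ↔ g a = g a')) :
    entropy p f = entropy p g := by
  rw [entropy_eq_sum, entropy_eq_sum]
  refine sum_toReal_mul_congr p fun a ha => ?_
  have : prob p f (f a) = prob p g (g a) := by
    rw [prob, prob, Finset.sum_filter, Finset.sum_filter]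
    refine Finset.sum_congr rfl fun a' _ => ?_
    by_cases ha' : p a' = 0
    · simp [ha']
    · simp only [h a' a ha' ha]
  rw [this]

theorem prob_le_one (p : PMF α) (f : α → β) (b : β) : prob p f b ≤ 1 :=
  (Finset.single_le_sum (f := prob p f) (fun _ _ => prob_nonneg p f _) (Finset.mem_univ b)).trans
    (sum_prob p f).le

theorem entropy_nonneg (p : PMF α) (f : α → β) : 0 ≤ entropy p f := by
  rw [entropy_eq_sum]
  refine Finset.sum_nonneg fun a _ => mul_nonneg ENNReal.toReal_nonneg (neg_nonneg.2 ?_)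
  exact Real.logb_nonpos one_lt_two (prob_nonneg p f _) (prob_le_one p f _)

theorem condEntropy_nonneg (p : PMF α) (f : α → β) (g : α → γ) : 0 ≤ condEntropy p f g := by
  rw [condEntropy_eq_sum]
  exact Finset.sum_nonneg fun a _ => toReal_mul_logb_nonneg p f g a

/-- If `H(f | g) = 0`, then `f` is determined by `g` on the support. -/
theorem logb_eq_zero_of_condEntropy_eq_zero (p : PMF α) (f : α → β) (g : α → γ)
    (h : condEntropy p f g = 0) {a : α} (ha : p a ≠ 0) :
    Real.logb 2 (prob p g (g a) / prob p (fun a => (f a, g a)) (f a, g a)) = 0 := by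
  rw [condEntropy_eq_sum,
    Finset.sum_eq_zero_iff_of_nonneg fun a _ => toReal_mul_logb_nonneg p f g a] at h
  exact (mul_eq_zero.1 (h a (Finset.mem_univ a))).resolve_left (toReal_pos_of_ne_zero p ha).ne'

theorem condEntropy_unit (p : PMF α) (f : α → β) :
    condEntropy p f (fun _ => ()) = entropy p f := by
  have h0 : entropy p (fun _ : α => ()) = 0 := by
    simp [entropy, prob, sum_toReal_eq_one]
  rw [condEntropy_eq_sub, h0, sub_zero]
  exact entropy_congr p _ _ fun a a' _ _ => by simp

end Entropy

/-! ### Entropies conditional on the common information -/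

section CommonInformation

variable {𝒳 𝒴 : Type*} [Fintype 𝒳] [Fintype 𝒴] (p : PMF (𝒳 × 𝒴))

theorem condEntropy_fst_commonInfo :
    condEntropy p Prod.fst (commonInfo p) = entropy p Prod.fst - entropy p (commonInfo p) := by
  rw [condEntropy_eq_sub]
  congr 1
  refine entropy_congr p _ _ fun a a' _ _ => ?_
  simp only [Prod.mk.injEq, and_iff_left_iff_imp]
  intro h
  simp [commonInfo, h]

theorem condEntropy_snd_commonInfo :
    condEntropy p Prod.snd (commonInfo p) = entropy p Prod.snd - entropy p (commonInfo p) := by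
  rw [condEntropy_eq_sub]
  congr 1
  refine entropy_congr p _ _ fun a a' ha ha' => ?_
  simp only [Prod.mk.injEq, and_iff_left_iff_imp]
  intro h
  rw [commonInfo_eq_right p a ha, commonInfo_eq_right p a' ha', h]


variable {p}

theorem condEntropy_fst_commonInfo_eq
    (hK : entropy p (commonInfo p) = mutualInfo p Prod.fst Prod.snd) :
    condEntropy p Prod.fst (commonInfo p) = condEntropy p Prod.fst Prod.snd := by
  rw [condEntropy_fst_commonInfo, hK, mutualInfo_eq, condEntropy_eq_sub]
  ring

theorem condEntropy_snd_commonInfo_eq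
    (hK : entropy p (commonInfo p) = mutualInfo p Prod.fst Prod.snd) :
    condEntropy p Prod.snd (commonInfo p) = condEntropy p Prod.snd Prod.fst := by
  have hswap : entropy p (fun a => (a.2, a.1)) = entropy p (fun a => (a.1, a.2)) :=
    entropy_congr p _ _ fun a a' _ _ => by simp [and_comm, Prod.ext_iff]
  rw [condEntropy_snd_commonInfo, hK, mutualInfo_eq, condEntropy_eq_sub, hswap]
  ring

theorem condEntropy_add_condEntropy_add_entropy
    (hK : entropy p (commonInfo p) = mutualInfo p Prod.fst Prod.snd) :
    condEntropy p Prod.fst (commonInfo p) + condEntropy p Prod.snd (commonInfo p) +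
      entropy p (commonInfo p) = entropy p id := by
  rw [condEntropy_fst_commonInfo, condEntropy_snd_commonInfo, hK, mutualInfo_eq]
  change _ = entropy p fun a => (a.1, a.2)
  ring

end CommonInformation

/-! ### Large deviations of i.i.d. sums -/

section Iid

variable {α : Type*} (p : PMF α)

theorem prod_toReal_nonneg {n : ℕ} (z : Fin n → α) : 0 ≤ ∏ i, (p (z i)).toReal :=
  Finset.prod_nonneg fun _ _ => ENNReal.toReal_nonneg

variable [Fintype α]

/-- Only sequences of positive probability matter in a comparison of probabilities. -/
theorem iidProb_mono {n : ℕ} {A B : Set (Fin n → α)}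
    (h : ∀ z ∈ A, (∀ i, p (z i) ≠ 0) → z ∈ B) : iidProb p n A ≤ iidProb p n B := by
  rw [iidProb, iidProb, Finset.sum_filter, Finset.sum_filter]
  refine Finset.sum_le_sum fun z _ => ?_
  by_cases hz : ∀ i, p (z i) ≠ 0
  · by_cases hA : z ∈ A
    · simp [hA, h z hA hz]
    · simp only [hA, if_false]
      split_ifs
      exacts [prod_toReal_nonneg p z, le_rfl]
  · push Not at hz
    obtain ⟨i, hi⟩ := hz
    have : ∏ i, (p (z i)).toReal = 0 := Finset.prod_eq_zero (Finset.mem_univ i) (by simp [hi])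
    simp [this]

theorem iidProb_union_le {n : ℕ} (A B : Set (Fin n → α)) :
    iidProb p n (A ∪ B) ≤ iidProb p n A + iidProb p n B := by
  rw [iidProb, iidProb, iidProb, Finset.sum_filter, Finset.sum_filter, Finset.sum_filter,
    ← Finset.sum_add_distrib]
  refine Finset.sum_le_sum fun z _ => ?_
  have := prod_toReal_nonneg p z
  by_cases hA : z ∈ A <;> by_cases hB : z ∈ B <;> simp [hA, hB, this]

theorem iidProb_empty (n : ℕ) : iidProb p n ∅ = 0 := by simp [iidProb]

/-- Chernoff's bound with a fixed exponent `s`. -/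
theorem iidProb_le_pow (h : α → ℝ) (μ s : ℝ) (hs : 0 ≤ s) (n : ℕ) :
    iidProb p n {z | n * μ ≤ ∑ i, h (z i)} ≤
      (∑ a, (p a).toReal * Real.exp (s * (h a - μ))) ^ n := by
  rw [Fintype.sum_pow, iidProb, Finset.sum_filter]
  refine Finset.sum_le_sum fun z _ => ?_
  rw [Finset.prod_mul_distrib, ← Real.exp_sum, ← Finset.mul_sum, Finset.sum_sub_distrib]
  have hp := prod_toReal_nonneg p z
  split_ifs with hz
  · refine le_mul_of_one_le_right hp (Real.one_le_exp (mul_nonneg hs ?_))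
    simpa using hz
  · exact mul_nonneg hp (Real.exp_pos _).le

/-- Above the mean, the exponential moment is less than `1` for a small positive exponent, because
its derivative at `0` is `E[h] - μ < 0`. -/
theorem exists_exp_moment_lt_one (h : α → ℝ) (μ : ℝ) (hμ : ∑ a, (p a).toReal * h a < μ) :
    ∃ s : ℝ, 0 < s ∧ ∑ a, (p a).toReal * Real.exp (s * (h a - μ)) < 1 := by
  have hd : HasDerivAt (fun s : ℝ => ∑ a, (p a).toReal * Real.exp (s * (h a - μ)))
      (∑ a, (p a).toReal * (h a - μ)) 0 := by
    refine HasDerivAt.fun_sum fun a _ => HasDerivAt.const_mul _ ?_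
    simpa using ((hasDerivAt_id (0 : ℝ)).mul_const (h a - μ)).exp
  have hneg : ∑ a, (p a).toReal * (h a - μ) < 0 := by
    simp only [mul_sub, Finset.sum_sub_distrib, ← Finset.sum_mul, sum_toReal_eq_one]
    linarith
  have hev := ((hasDerivWithinAt_iff_tendsto_slope' Set.self_notMem_Ioi).1
    hd.hasDerivWithinAt).eventually_lt_const hneg
  obtain ⟨s, hs, hs0⟩ := (hev.and self_mem_nhdsWithin).exists
  refine ⟨s, hs0, ?_⟩
  rw [slope_def_field, sub_zero, div_lt_iff₀ hs0] at hs
  simpa [sum_toReal_eq_one] using hs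

/-- The weak law of large numbers, upper tail. -/
theorem eventually_iidProb_le (h : α → ℝ) (μ ε : ℝ) (hμ : ∑ a, (p a).toReal * h a < μ)
    (hε : 0 < ε) :
    ∀ᶠ n : ℕ in Filter.atTop, iidProb p n {z | n * μ ≤ ∑ i, h (z i)} ≤ ε := by
  obtain ⟨s, hs, hq⟩ := exists_exp_moment_lt_one p h μ hμ
  have h0 : 0 ≤ ∑ a, (p a).toReal * Real.exp (s * (h a - μ)) :=
    Finset.sum_nonneg fun a _ => mul_nonneg ENNReal.toReal_nonneg (Real.exp_pos _).le
  filter_upwards [(tendsto_pow_atTop_nhds_zero_of_lt_one h0 hq).eventually_lt_const hε] with n hn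
  exact (iidProb_le_pow p h μ s hs.le n).trans hn.le

end Iid

/-! ### Source coding with side information -/

section SourceCoding

variable {α β γ : Type*} [Fintype α] (p : PMF α) (f : α → β) (g : α → γ)

/-- The conditional self-information `log₂ (1 / P(f = f a | g = g a))`. -/
noncomputable def condInfo (a : α) : ℝ :=
  Real.logb 2 (prob p g (g a) / prob p (fun a => (f a, g a)) (f a, g a))

/-- The sequences `b` with `P(b | c) ≥ 2 ^ (-r)`, without the division by `P(c)`. -/
noncomputable def condTypical [Fintype β] (n r : ℕ) (c : Fin n → γ) : Finset (Fin n → β) :=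
  {b | ∏ i, prob p g (c i) ≤ 2 ^ r * ∏ i, prob p (fun a => (f a, g a)) (b i, c i)}

theorem card_condTypical_le [Fintype β] (n r : ℕ) (c : Fin n → γ) (hc : ∀ i, 0 < prob p g (c i)) :
    (condTypical p f g n r c).card ≤ 2 ^ r := by
  have hpos : 0 < ∏ i, prob p g (c i) := Finset.prod_pos fun i _ => hc i
  have hsum : ∑ b : Fin n → β, ∏ i, prob p (fun a => (f a, g a)) (b i, c i) =
      ∏ i, prob p g (c i) := by
    rw [← Fintype.piFinset_univ,
      ← Finset.prod_univ_sum (fun _ => Finset.univ)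
        fun i b => prob p (fun a => (f a, g a)) (b, c i)]
    exact Finset.prod_congr rfl fun i _ => sum_prob_pair p f g (c i)
  have key : ((condTypical p f g n r c).card : ℝ) * ∏ i, prob p g (c i) ≤
      2 ^ r * ∏ i, prob p g (c i) := by
    rw [← nsmul_eq_mul, ← hsum, Finset.mul_sum]
    refine (Finset.card_nsmul_le_sum _ _ _ fun b hb => ?_).trans
      (Finset.sum_le_sum_of_subset_of_nonneg (Finset.subset_univ _) fun b _ _ => ?_)
    · rw [hsum]
      exact (Finset.mem_filter.1 hb).2
    · exact mul_nonneg (by positivity) (Finset.prod_nonneg fun i _ => prob_nonneg p _ _)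
  exact_mod_cast le_of_mul_le_mul_right key hpos

theorem mem_condTypical [Fintype β] {n r : ℕ} {z : Fin n → α} (hz : ∀ i, p (z i) ≠ 0)
    (h : ∑ i, condInfo p f g (z i) ≤ r) :
    (fun i => f (z i)) ∈ condTypical p f g n r fun i => g (z i) := by
  have hfg : ∀ i, 0 < prob p (fun a => (f a, g a)) (f (z i), g (z i)) :=
    fun i => prob_pos p (fun a => (f a, g a)) (hz i)
  have hg : ∀ i, 0 < prob p g (g (z i)) := fun i => prob_pos p g (hz i)
  have hprod : 0 < ∏ i, prob p (fun a => (f a, g a)) (f (z i), g (z i)) :=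
    Finset.prod_pos fun i _ => hfg i
  simp only [condInfo] at h
  rw [← Real.logb_prod _ _ fun i _ => (div_pos (hg i) (hfg i)).ne', Finset.prod_div_distrib,
    Real.logb_le_iff_le_rpow one_lt_two (div_pos (Finset.prod_pos fun i _ => hg i) hprod),
    div_le_iff₀ hprod, Real.rpow_natCast] at h
  simpa [condTypical] using h

/-- A code of `r` bits for `f^n` with the side information `g^n` at the decoder. The encoder sees
`f^n` only, but it can compute the side information because `g = π ∘ f` on the support of `p`. -/
theorem exists_encoder_decoder [Fintype β] [Nonempty β] (π : β → γ)
    (hπ : ∀ a, p a ≠ 0 → g a = π (f a)) (n r : ℕ) :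
    ∃ (enc : (Fin n → β) → Fin (2 ^ r)) (dec : (Fin n → γ) → Fin (2 ^ r) → Fin n → β),
      ∀ z : Fin n → α, (∀ i, p (z i) ≠ 0) → ∑ i, condInfo p f g (z i) ≤ r →
        dec (fun i => g (z i)) (enc fun i => f (z i)) = fun i => f (z i) := by
  have hex : ∀ c : Fin n → γ, ∃ e : (Fin n → β) → Fin (2 ^ r), (∀ i, 0 < prob p g (c i)) →
      Set.InjOn e (condTypical p f g n r c : Set (Fin n → β)) := by
    intro c
    by_cases hc : ∀ i, 0 < prob p g (c i)
    · have hcard : (condTypical p f g n r c : Set (Fin n → β)).encard ≤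
          (Set.univ : Set (Fin (2 ^ r))).encard := by
        rw [Set.encard_coe_eq_coe_finsetCard, Set.encard_univ, ENat.card_eq_coe_fintype_card,
          Fintype.card_fin]
        exact_mod_cast card_condTypical_le p f g n r c hc
      obtain ⟨e, -, he⟩ := (Finset.finite_toSet _).exists_injOn_of_encard_le hcard
      exact ⟨e, fun _ => he⟩
    · exact ⟨fun _ => 0, fun h => (hc h).elim⟩
  choose e he using hex
  refine ⟨fun b => e (fun i => π (b i)) b,
    fun c => Function.invFunOn (e c) (condTypical p f g n r c : Set (Fin n → β)),
    fun z hz h => ?_⟩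
  have hg : (fun i => π (f (z i))) = fun i => g (z i) := funext fun i => (hπ _ (hz i)).symm
  simp only [hg]
  exact (he _ fun i => prob_pos p g (hz i)).leftInvOn_invFunOn (mem_condTypical p f g hz h)

theorem sum_mul_condInfo [Fintype β] [Fintype γ] :
    ∑ a, (p a).toReal * condInfo p f g a = condEntropy p f g :=
  (condEntropy_eq_sum p f g).symm

/-- The number of code bits for blocks of length `n` of a source of entropy rate `h`, with the
excess rate `δ`. A source of rate `0` gets no bits at all, since the network may be
unable to carry any. -/
noncomputable def codeLength (h δ : ℝ) (n : ℕ) : ℕ := if h = 0 then 0 else ⌊n * (h + δ)⌋₊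

theorem codeLength_le {h δ : ℝ} (hh : 0 ≤ h) (hδ : 0 ≤ δ) (n : ℕ) :
    (codeLength h δ n : ℝ) ≤ n * (h + δ) := by
  have : 0 ≤ n * (h + δ) := by positivity
  rw [codeLength]
  split_ifs
  · simpa using this
  · exact Nat.floor_le this

/-- With any excess rate `δ`, sequences of self-information more than the code length are
asymptotically improbable. For entropy rate `0` they are impossible. -/
theorem eventually_iidProb_codeLength_lt_le [Fintype β] [Fintype γ] {δ ε : ℝ} (hδ : 0 < δ)
    (hε : 0 < ε) :
    ∀ᶠ n : ℕ in Filter.atTop, iidProb p n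
      {z | (codeLength (condEntropy p f g) δ n : ℝ) < ∑ i, condInfo p f g (z i)} ≤ ε := by
  by_cases h0 : condEntropy p f g = 0
  · refine Filter.Eventually.of_forall fun n => ?_
    refine ((iidProb_mono p fun z hz hpos => ?_).trans (iidProb_empty p n).le).trans hε.le
    have : ∑ i, condInfo p f g (z i) = 0 :=
      Finset.sum_eq_zero fun i _ => logb_eq_zero_of_condEntropy_eq_zero p f g h0 (hpos i)
    simp [this, codeLength, h0] at hz
  · have hlt : ∑ a, (p a).toReal * condInfo p f g a < condEntropy p f g + δ / 2 := by
      rw [sum_mul_condInfo]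
      linarith
    filter_upwards [eventually_iidProb_le p (condInfo p f g) _ ε hlt hε,
      Filter.eventually_ge_atTop ⌈2 / δ⌉₊] with n hn hnδ
    refine (iidProb_mono p fun z hz _ => ?_).trans hn
    have h1 : 2 / δ ≤ n := Nat.ceil_le.1 hnδ
    rw [div_le_iff₀ hδ] at h1
    have h2 := Nat.lt_floor_add_one (n * (condEntropy p f g + δ))
    simp only [codeLength, h0, if_false, Set.mem_ofPred_eq] at hz ⊢
    nlinarith

end SourceCoding

section Decomposition

variable {𝒳 𝒴 : Type*} [Fintype 𝒳] [Fintype 𝒴] (p : PMF (𝒳 × 𝒴))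

theorem latentRate_nonneg (j : Latent) : 0 ≤ latentRate p j := by
  cases j
  exacts [condEntropy_nonneg _ _ _, condEntropy_nonneg _ _ _, entropy_nonneg _ _]

/-- The three code words can be made with any excess rate. -/
theorem eventually_decompositionCode {δ ε : ℝ} (hδ : 0 < δ) (hε : 0 < ε) :
    ∀ᶠ n : ℕ in Filter.atTop,
      DecompositionCode p n (fun j => codeLength (latentRate p j) δ n) ε := by
  have hε3 : 0 < ε / 3 := by positivity
  have hKrate : condEntropy p (commonInfo p) (fun _ => ()) = latentRate p .K :=
    condEntropy_unit p _
  obtain ⟨a, -⟩ := p.support_nonempty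
  have : Nonempty 𝒳 := ⟨a.1⟩
  have : Nonempty 𝒴 := ⟨a.2⟩
  have : Nonempty (Common p) := ⟨commonInfo p a⟩
  filter_upwards [
    eventually_iidProb_codeLength_lt_le p (commonInfo p) (fun _ => ()) hδ hε3,
    eventually_iidProb_codeLength_lt_le p Prod.fst (commonInfo p) hδ hε3,
    eventually_iidProb_codeLength_lt_le p Prod.snd (commonInfo p) hδ hε3] with n hnK hnX hnY
  rw [hKrate] at hnK
  obtain ⟨encK, decK, hcK⟩ := exists_encoder_decoder p (commonInfo p) (fun _ => ())
    (fun _ => ()) (fun _ _ => rfl) n (codeLength (latentRate p .K) δ n)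
  obtain ⟨encX, decX, hcX⟩ := exists_encoder_decoder p Prod.fst (commonInfo p)
    (fun x => (bipartite p).connectedComponentMk (Sum.inl x)) (fun _ _ => rfl) n
    (codeLength (latentRate p .X') δ n)
  obtain ⟨encY, decY, hcY⟩ := exists_encoder_decoder p Prod.snd (commonInfo p)
    (fun y => (bipartite p).connectedComponentMk (Sum.inr y)) (commonInfo_eq_right p) n
    (codeLength (latentRate p .Y') δ n)
  refine ⟨encK, encX, encY, decK fun _ => (), decX, decY, ?_⟩
  have hsub := iidProb_mono p (n := n) (B :=
    {z | (codeLength (latentRate p .K) δ n : ℝ) <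
        ∑ i, condInfo p (commonInfo p) (fun _ => ()) (z i)} ∪
      ({z | (codeLength (latentRate p .X') δ n : ℝ) <
        ∑ i, condInfo p Prod.fst (commonInfo p) (z i)} ∪
      {z | (codeLength (latentRate p .Y') δ n : ℝ) <
        ∑ i, condInfo p Prod.snd (commonInfo p) (z i)}))
    (A := {z | ¬ (
      let k := fun i => commonInfo p (z i)
      let x := fun i => (z i).1
      let y := fun i => (z i).2
      let k' := decK (fun _ => ()) (encK k)
      k' = k ∧ decX k' (encX x) = x ∧ decY k' (encY y) = y)}) ?_
  · refine hsub.trans ((iidProb_union_le p _ _).trans ?_)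
    have h1 := iidProb_union_le p (n := n)
      {z | (codeLength (latentRate p .X') δ n : ℝ) <
        ∑ i, condInfo p Prod.fst (commonInfo p) (z i)}
      {z | (codeLength (latentRate p .Y') δ n : ℝ) <
        ∑ i, condInfo p Prod.snd (commonInfo p) (z i)}
    simp only [latentRate] at h1 hnK ⊢
    linarith
  · intro z hz hpos
    by_contra hnot
    simp only [Set.mem_union, Set.mem_ofPred_eq, not_or, not_lt] at hnot
    refine hz ?_
    have hk := hcK z hpos hnot.1
    dsimp only
    rw [hk]
    exact ⟨rfl, hcX z hpos hnot.2.1, hcY z hpos hnot.2.2⟩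

end Decomposition

/-! ### Random linear network codes over `𝔽₂` -/

section RandomLinearMap

variable {U W : Type*} [AddCommGroup U] [AddCommGroup W] [Module (ZMod 2) U] [Module (ZMod 2) W]
  [Finite U] [Finite W]

noncomputable instance instFintypeLinearMap : Fintype (U →ₗ[ZMod 2] W) :=
  have := DFunLike.finite (U →ₗ[ZMod 2] W)
  Fintype.ofFinite _

/-- A uniformly random linear map sends each nonzero vector to a uniformly random vector. -/
theorem card_linearMap_apply_eq [Fintype W] [DecidableEq W] {x : U} (hx : x ≠ 0) (y : W) :
    Finset.card {M : U →ₗ[ZMod 2] W | M x = y} * Fintype.card W =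
      Fintype.card (U →ₗ[ZMod 2] W) := by
  have hfib : ∀ y' : W, Finset.card {M : U →ₗ[ZMod 2] W | M x = y'} =
      Finset.card {M : U →ₗ[ZMod 2] W | M x = y} := by
    intro y'
    obtain ⟨N, -, hN⟩ := LinearMap.exists_extend_of_notMem (0 : (⊥ : Submodule (ZMod 2) U) →ₗ[_] W)
      (by simpa using hx : x ∉ (⊥ : Submodule (ZMod 2) U)) (y - y')
    refine Finset.card_equiv (Equiv.addRight N) fun M => ?_
    simp [hN, ← eq_sub_iff_add_eq]
  calc _ = ∑ y' : W, Finset.card {M : U →ₗ[ZMod 2] W | M x = y'} := by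
        rw [Finset.sum_congr rfl fun y' _ => hfib y', Finset.sum_const, smul_eq_mul,
          Finset.card_univ, mul_comm]
    _ = _ := (Finset.card_eq_sum_card_fiberwise (fun _ _ => Finset.mem_univ _)).symm

end RandomLinearMap

section LinearCode

variable {V E ι : Type*} (G : Network V E) (c : E → ℕ) (r : ι → ℕ) (av : V → Set ι)

/-- Tuples of messages of `r j` bits. -/
abbrev Msg : Type _ := ∀ j, Fin (r j) → ZMod 2

/-- Assignments of `c e` bits to each edge `e`. -/
abbrev Sym : Type _ := ∀ e, Fin (c e) → ZMod 2

/-- What is visible at the node `v`: the messages with index in `av v` and the symbols on the edges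
that enter `v`. Everything else is replaced by `0`, so that all the nodes share one space. -/
noncomputable def view (v : V) (d : Msg r) (w : Sym c) : Msg r × Sym c :=
  (fun j => if j ∈ av v then d j else 0, fun e => if G.tgt e = v then w e else 0)

variable {G c r av}

theorem view_eq_view_iff {v : V} {d d' : Msg r} {w w' : Sym c} :
    view G c r av v d w = view G c r av v d' w' ↔
      (∀ j ∈ av v, d j = d' j) ∧ ∀ e, G.tgt e = v → w e = w' e := by
  simp only [view, Prod.mk.injEq, funext_iff (f := fun j => ite (j ∈ av v) _ _),
    funext_iff (f := fun e => ite (G.tgt e = v) _ _)]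
  refine and_congr (forall_congr' fun j => ?_) (forall_congr' fun e => ?_)
  · by_cases h : j ∈ av v <;> simp [h]
  · by_cases h : G.tgt e = v <;> simp [h]

theorem view_zero (v : V) : view G c r av v 0 0 = 0 := by
  ext <;> simp [view]

theorem view_eq_zero_iff {v : V} {d : Msg r} {w : Sym c} :
    view G c r av v d w = 0 ↔ (∀ j ∈ av v, d j = 0) ∧ ∀ e, G.tgt e = v → w e = 0 := by
  rw [← view_zero v, view_eq_view_iff]
  rfl

theorem view_sub (v : V) (d d' : Msg r) (w w' : Sym c) :
    view G c r av v (d - d') (w - w') = view G c r av v d w - view G c r av v d' w' := by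
  refine Prod.ext (funext fun j => ?_) (funext fun e => ?_)
  · by_cases h : j ∈ av v <;> simp [view, h]
  · by_cases h : G.tgt e = v <;> simp [view, h]

variable (c r) in
/-- A linear network code: one linear encoding map for each edge. -/
abbrev LinCode : Type _ := ∀ e : E, (Msg r × Sym c) →ₗ[ZMod 2] (Fin (c e) → ZMod 2)

variable (G av) in
/-- `w` is a consistent assignment of symbols when the messages are `d`. -/
def IsRun (M : LinCode c r) (d : Msg r) (w : Sym c) : Prop :=
  ∀ e, M e (view G c r av (G.src e) d w) = w e

theorem IsRun.sub {M : LinCode c r} {d d' : Msg r} {w w' : Sym c} (h : IsRun G av M d w)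
    (h' : IsRun G av M d' w') : IsRun G av M (d - d') (w - w') := by
  intro e
  rw [view_sub, map_sub, h e, h' e, Pi.sub_apply]

theorem wellFounded_of_acyclic [Finite E] (hG : G.Acyclic) :
    WellFounded fun e' e : E => G.tgt e' = G.src e := by
  let R : E → E → Prop := fun e' e => G.tgt e' = G.src e
  have hirr : Std.Irrefl (Relation.TransGen R) := ⟨fun e he =>
    hG (G.tgt e) (he.lift G.tgt fun a b hab => ⟨b, hab.symm, rfl⟩)⟩
  exact Subrelation.wf (fun h => Relation.TransGen.single (r := R) h)
    (Finite.wellFounded_of_trans_of_irrefl (Relation.TransGen R))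

/-- In an acyclic network the symbols can be computed edge by edge. -/
theorem exists_isRun [Finite E] (hG : G.Acyclic) (M : LinCode c r) (d : Msg r) :
    ∃ w, IsRun G av M d w := by
  have hwf := wellFounded_of_acyclic hG
  let w : Sym c := hwf.fix fun e rec =>
    M e (fun j => if j ∈ av (G.src e) then d j else 0,
      fun e' => if h : G.tgt e' = G.src e then rec e' h else 0)
  refine ⟨w, fun e => ?_⟩
  have hw : w e = M e (fun j => if j ∈ av (G.src e) then d j else 0,
      fun e' => if h : G.tgt e' = G.src e then w e' else 0) := hwf.fix_eq _ e
  rw [hw]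
  simp only [dite_eq_ite]
  rfl

variable [Fintype V] [Fintype E] [Fintype ι]

/-- For fixed messages `d`, the probability that a random code has a run in which exactly the nodes
in `S` see something nonzero is at most `2 ^ (-cut S)`. Each such run fixes the
symbols on the edges that do not lie inside `S`, and is consistent with probability
`2 ^ (-c e)` at each edge with tail in `S`. The union bound over the runs leaves
the factors of the edges that leave `S`. -/
theorem card_linCode_isRun_le (d : Msg r) (S : Set V) :
    Finset.card {M : LinCode c r | ∃ w, IsRun G av M d w ∧
        ∀ v, v ∈ S ↔ view G c r av v d w ≠ 0} *
      2 ^ (∑ e with G.src e ∈ S ∧ G.tgt e ∉ S, c e) ≤ Fintype.card (LinCode c r) := by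
  let R : Finset (Sym c) :=
    {w | (∀ v, v ∈ S ↔ view G c r av v d w ≠ 0) ∧ ∀ e, G.src e ∉ S → w e = 0}
  have hview : ∀ w ∈ R, ∀ v, v ∈ S ↔ view G c r av v d w ≠ 0 :=
    fun w hw => (Finset.mem_filter.1 hw).2.1
  have hcover : ({M : LinCode c r | ∃ w, IsRun G av M d w ∧
        ∀ v, v ∈ S ↔ view G c r av v d w ≠ 0} : Finset (LinCode c r)) ⊆
      R.biUnion fun w => {M | IsRun G av M d w} := by
    intro M hM
    obtain ⟨w, hw, hS⟩ := (Finset.mem_filter.1 hM).2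
    refine Finset.mem_biUnion.2 ⟨w, Finset.mem_filter.2 ⟨Finset.mem_univ _, hS, fun e he => ?_⟩,
      Finset.mem_filter.2 ⟨Finset.mem_univ _, hw⟩⟩
    rw [← hw e, not_not.1 (mt (hS _).2 he), map_zero]
  have hrun : ∀ w ∈ R, Finset.card {M : LinCode c r | IsRun G av M d w} *
      2 ^ (∑ e with G.src e ∈ S, c e) = Fintype.card (LinCode c r) := by
    intro w hw
    have hpi : ({M : LinCode c r | IsRun G av M d w} : Finset (LinCode c r)) =
        Fintype.piFinset fun e => {N | N (view G c r av (G.src e) d w) = w e} := by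
      ext M
      simp only [Fintype.mem_piFinset, Finset.mem_filter, Finset.mem_univ, true_and]
      rfl
    rw [hpi, Fintype.card_piFinset, Fintype.card_pi, ← Finset.prod_pow_eq_pow_sum,
      Finset.prod_filter, ← Finset.prod_mul_distrib]
    refine Finset.prod_congr rfl fun e _ => ?_
    by_cases he : G.src e ∈ S
    · rw [if_pos he, ← card_linearMap_apply_eq ((hview w hw _).1 he) (w e)]
      simp
    · rw [if_neg he, mul_one, not_not.1 (mt (hview w hw _).2 he),
        (Finset.mem_filter.1 hw).2.2 e he]
      simp
  have hR : R.card ≤ 2 ^ (∑ e with G.src e ∈ S ∧ G.tgt e ∈ S, c e) := by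
    have hsub : R ⊆ Fintype.piFinset fun e =>
        if G.src e ∈ S ∧ G.tgt e ∈ S then Finset.univ else {0} := by
      intro w hw
      rw [Fintype.mem_piFinset]
      intro e
      split_ifs with he
      · exact Finset.mem_univ _
      · rw [Finset.mem_singleton]
        by_cases hs : G.src e ∈ S
        · have ht : view G c r av (G.tgt e) d w = 0 :=
            not_not.1 (mt (hview w hw _).2 fun ht => he ⟨hs, ht⟩)
          exact (view_eq_zero_iff.1 ht).2 e rfl
        · exact (Finset.mem_filter.1 hw).2.2 e hs
    refine (Finset.card_le_card hsub).trans (le_of_eq ?_)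
    rw [Fintype.card_piFinset, ← Finset.prod_pow_eq_pow_sum, Finset.prod_filter]
    refine Finset.prod_congr rfl fun e _ => ?_
    split_ifs <;> simp
  have hsplit : ∑ e with G.src e ∈ S, c e = ∑ e with G.src e ∈ S ∧ G.tgt e ∈ S, c e +
      ∑ e with G.src e ∈ S ∧ G.tgt e ∉ S, c e := by
    rw [← Finset.sum_filter_add_sum_filter_not _ fun e => G.tgt e ∈ S, Finset.filter_filter,
      Finset.filter_filter]
  have htotal := (Nat.mul_le_mul_right (2 ^ (∑ e with G.src e ∈ S, c e))
    ((Finset.card_le_card hcover).trans Finset.card_biUnion_le)).trans_eq (by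
      rw [Finset.sum_mul, Finset.sum_congr rfl hrun, Finset.sum_const, smul_eq_mul])
  rw [hsplit, pow_add] at htotal
  refine Nat.le_of_mul_le_mul_left ?_ (Nat.two_pow_pos (∑ e with G.src e ∈ S ∧ G.tgt e ∈ S, c e))
  calc _ = _ := mul_left_comm _ _ _
    _ ≤ _ := htotal
    _ ≤ _ := Nat.mul_le_mul_right _ hR

/-- There are at most `2 ^ (∑ j ∈ J, r j)` message tuples with support `J`,
so each of the sets `J` contributes at most `1`. -/
theorem sum_half_pow_le :
    ∑ d : Msg r, (1 / 2 : ℝ) ^ (∑ j with d j ≠ 0, r j) ≤ 2 ^ Fintype.card ι := by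
  have h1 : ∀ d : Msg r, (1 / 2 : ℝ) ^ (∑ j with d j ≠ 0, r j) =
      ∏ j, if d j ≠ 0 then (1 / 2 : ℝ) ^ r j else 1 := by
    intro d
    rw [← Finset.prod_pow_eq_pow_sum, Finset.prod_filter]
  have h2 : ∀ j, ∑ x : Fin (r j) → ZMod 2, (if x ≠ 0 then (1 / 2 : ℝ) ^ r j else 1) ≤ 2 := by
    intro j
    calc ∑ x : Fin (r j) → ZMod 2, (if x ≠ 0 then (1 / 2 : ℝ) ^ r j else 1)
        ≤ ∑ x : Fin (r j) → ZMod 2, ((1 / 2 : ℝ) ^ r j + if x = 0 then 1 else 0) := by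
          refine Finset.sum_le_sum fun x _ => ?_
          by_cases hx : x = 0 <;> simp [hx]
      _ = 2 := by
          rw [Finset.sum_add_distrib, Finset.sum_const, Finset.sum_ite_eq']
          simp
          norm_num
  simp only [h1]
  rw [← Fintype.piFinset_univ,
    ← Finset.prod_univ_sum (fun _ => Finset.univ)
      fun j (x : Fin (r j) → ZMod 2) => if x ≠ 0 then (1 / 2 : ℝ) ^ r j else 1]
  calc _ ≤ ∏ _j : ι, (2 : ℝ) := Finset.prod_le_prod
        (fun j _ => Finset.sum_nonneg fun x _ => by split_ifs <;> positivity) fun j _ => h2 j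
    _ = _ := by simp

/-- If every cut between the messages in `J` and a terminal has room for these messages and a
constant number of further bits, then some linear network code has no run in
which the messages do not all vanish but a terminal sees only zeros. -/
theorem exists_linCode (T : Finset V)
    (hcut : ∀ J : Finset ι, J.Nonempty → (∀ j ∈ J, 0 < r j) → ∀ S : Set V, (∃ t ∈ T, t ∉ S) →
      (∀ v, (∃ j ∈ av v, j ∈ J) → v ∈ S) →
      ∑ j ∈ J, r j + (Fintype.card V + Fintype.card ι + 1) ≤
        ∑ e with G.src e ∈ S ∧ G.tgt e ∉ S, c e) :
    ∃ M : LinCode c r, ∀ d w, IsRun G av M d w → ∀ t ∈ T, view G c r av t d w = 0 → d = 0 := by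
  by_contra! hbad
  let B : Msg r → Set V → Finset (LinCode c r) := fun d S =>
    {M | (∃ w, IsRun G av M d w ∧ ∀ v, v ∈ S ↔ view G c r av v d w ≠ 0) ∧
      d ≠ 0 ∧ ∃ t ∈ T, t ∉ S}
  have hcover : (Finset.univ : Finset (LinCode c r)) ⊆
      Finset.univ.biUnion fun d => Finset.univ.biUnion (B d) := by
    intro M _
    obtain ⟨d, w, hw, t, ht, hv, hd⟩ := hbad M
    simp only [Finset.mem_biUnion, Finset.mem_univ, true_and, B, Finset.mem_filter]
    exact ⟨d, {v | view G c r av v d w ≠ 0}, ⟨w, hw, fun v => Iff.rfl⟩, hd, t, ht, by simp [hv]⟩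
  have hB : ∀ d S, ((B d S).card : ℝ) ≤ (1 / 2) ^ (∑ j with d j ≠ 0, r j) *
      ((1 / 2) ^ (Fintype.card V + Fintype.card ι + 1) * Fintype.card (LinCode c r)) := by
    intro d S
    rcases (B d S).eq_empty_or_nonempty with he | ⟨M, hM⟩
    · rw [he, Finset.card_empty, Nat.cast_zero]
      positivity
    obtain ⟨⟨w, hw, hS⟩, hd, hT⟩ := (Finset.mem_filter.1 hM).2
    have hroom := hcut {j | d j ≠ 0} ?_ ?_ S hT ?_
    · have hsub : B d S ⊆ ({M : LinCode c r | ∃ w, IsRun G av M d w ∧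
          ∀ v, v ∈ S ↔ view G c r av v d w ≠ 0} : Finset (LinCode c r)) :=
        fun M hM => Finset.mem_filter.2 ⟨Finset.mem_univ M, (Finset.mem_filter.1 hM).2.1⟩
      have h1 := (Nat.mul_le_mul_left _ (Nat.pow_le_pow_right two_pos hroom)).trans
        ((Nat.mul_le_mul_right _ (Finset.card_le_card hsub)).trans
          (card_linCode_isRun_le (G := G) (av := av) d S))
      rw [← mul_assoc, ← pow_add, one_div, inv_pow, inv_mul_eq_div, le_div_iff₀ (by positivity)]
      exact_mod_cast h1
    · obtain ⟨j, hj⟩ := Function.ne_iff.1 hd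
      exact ⟨j, by simpa using hj⟩
    · -- a message of no bits vanishes
      intro j hj
      by_contra h0
      have : IsEmpty (Fin (r j)) := by
        rw [Nat.eq_zero_of_not_pos h0]
        infer_instance
      exact (Finset.mem_filter.1 hj).2 (Subsingleton.elim _ _)
    · rintro v ⟨j, hj, hjd⟩
      rw [hS, Ne, view_eq_zero_iff]
      exact fun h => (Finset.mem_filter.1 hjd).2 (h.1 j hj)
  have hcard : (Fintype.card (LinCode c r) : ℝ) ≤ ∑ d : Msg r, ∑ S : Set V, ((B d S).card : ℝ) := by
    rw [← Finset.card_univ]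
    refine (Nat.cast_le.2 ((Finset.card_le_card hcover).trans (Finset.card_biUnion_le.trans
      (Finset.sum_le_sum fun d _ => Finset.card_biUnion_le)))).trans ?_
    push_cast
    exact le_rfl
  have hpos : (0 : ℝ) < Fintype.card (LinCode c r) := by
    exact_mod_cast Fintype.card_pos
  have hlt : ∑ d : Msg r, ∑ S : Set V, ((B d S).card : ℝ) ≤
      Fintype.card (LinCode c r) / 2 := by
    calc _ ≤ ∑ d : Msg r, ∑ _S : Set V, (1 / 2 : ℝ) ^ (∑ j with d j ≠ 0, r j) *
          ((1 / 2) ^ (Fintype.card V + Fintype.card ι + 1) * Fintype.card (LinCode c r)) :=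
        Finset.sum_le_sum fun d _ => Finset.sum_le_sum fun S _ => hB d S
      _ = (∑ d : Msg r, (1 / 2 : ℝ) ^ (∑ j with d j ≠ 0, r j)) * (2 ^ Fintype.card V *
          ((1 / 2) ^ (Fintype.card V + Fintype.card ι + 1) * Fintype.card (LinCode c r))) := by
        rw [Finset.sum_mul]
        refine Finset.sum_congr rfl fun d _ => ?_
        rw [Finset.sum_const, Finset.card_univ, Fintype.card_set, nsmul_eq_mul]
        push_cast
        ring
      _ ≤ 2 ^ Fintype.card ι * (2 ^ Fintype.card V *
          ((1 / 2) ^ (Fintype.card V + Fintype.card ι + 1) * Fintype.card (LinCode c r))) :=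
        mul_le_mul_of_nonneg_right sum_half_pow_le (by positivity)
      _ = _ := by
        rw [one_div, inv_pow, pow_succ, pow_add]
        field_simp
  linarith

/-- The network coding theorem with a constant number of spare bits in each cut, for messages
that may be available at several nodes. -/
theorem exists_networkCode (hG : G.Acyclic) (T : Finset V)
    (hcut : ∀ J : Finset ι, J.Nonempty → (∀ j ∈ J, 0 < r j) → ∀ S : Set V, (∃ t ∈ T, t ∉ S) →
      (∀ v, (∃ j ∈ av v, j ∈ J) → v ∈ S) →
      ∑ j ∈ J, r j + (Fintype.card V + Fintype.card ι + 1) ≤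
        ∑ e with G.src e ∈ S ∧ G.tgt e ∉ S, c e) :
    ∃ φ : Msg r → Sym c,
      (∀ e m m', (∀ j ∈ av (G.src e), m j = m' j) →
        (∀ e', G.tgt e' = G.src e → φ m e' = φ m' e') → φ m e = φ m' e) ∧
      ∀ t ∈ T, ∀ m m', (∀ j ∈ av t, m j = m' j) →
        (∀ e', G.tgt e' = t → φ m e' = φ m' e') → m = m' := by
  obtain ⟨M, hM⟩ := exists_linCode T hcut
  choose φ hφ using fun d => exists_isRun (av := av) hG M d
  refine ⟨φ, fun e m m' hm he => ?_, fun t ht m m' hm he => ?_⟩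
  · rw [← hφ m e, ← hφ m' e, view_eq_view_iff.2 ⟨hm, he⟩]
  · refine sub_eq_zero.1 (hM (m - m') (φ m - φ m') ((hφ m).sub (hφ m')) t ht ?_)
    rw [view_sub, view_eq_view_iff.2 ⟨hm, he⟩, sub_self]

end LinearCode

/-! ### Cuts of a network and of its expansion -/

section Cuts

theorem coe_le_coe_enat_iff (h : ℝ) (x : ℕ∞) :
    (h : EReal) ≤ ((x : ℝ≥0∞) : EReal) ↔ (⌈h⌉₊ : ℕ∞) ≤ x := by
  induction x using ENat.recTopCoe with
  | top => simp
  | coe k =>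
    have hk : (((k : ℕ∞) : ℝ≥0∞) : EReal) = ((k : ℝ) : EReal) := by
      rw [ENat.toENNReal_coe, ← ENNReal.coe_natCast, EReal.coe_nnreal_eq_coe_real,
        NNReal.coe_natCast]
    rw [hk, EReal.coe_le_coe_iff, Nat.cast_le, Nat.ceil_le]

variable {V E : Type*} {G : Network V E}

theorem rateLE_iff [Fintype E] {T : Finset V} {h : ℝ} {A : Set V} :
    G.RateLE T h A ↔
      ∀ t ∈ T, ∀ S : Set V, A ⊆ S → t ∉ S → (⌈h⌉₊ : ℕ∞) ≤ G.cutCap S := by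
  simp only [Network.RateLE, coe_le_coe_enat_iff, Network.capFun, Network.minCut, le_iInf_iff,
    and_imp]

instance instFintypeLatent : Fintype Latent where
  elems := {.X', .Y', .K}
  complete j := by cases j <;> simp

theorem sum_latent (F : Latent → ℝ) : ∑ j, F j = F .X' + F .Y' + F .K := by
  change ∑ j ∈ ({.X', .Y', .K} : Finset Latent), F j = _
  rw [Finset.sum_insert (by simp), Finset.sum_insert (by simp), Finset.sum_singleton, add_assoc]

/-- The latent sources whose messages reach the node `v` of `G` over the edges of
infinite capacity. -/
def avail (sx sy v : V) : Set Latent :=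
  {j | v = sx ∧ (j = .X' ∨ j = .K) ∨ v = sy ∧ (j = .Y' ∨ j = .K)}

/-- The conditions on cuts that are equivalent to the GK-separation conditions: three conditions
suffice for the seven sets of latent sources, because `s_K` reaches both `sx` and `sy`. -/
theorem ceil_sum_latentRate_le_cutCap {𝒳 𝒴 : Type*} [Fintype E] [Fintype 𝒳] [Fintype 𝒴] {sx sy : V}
    {T : Finset V} {p : PMF (𝒳 × 𝒴)} (h : GKConditions G sx sy T p) {J : Finset Latent}
    (hJ : J.Nonempty) {S : Set V} (hT : ∃ t ∈ T, t ∉ S)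
    (hS : ∀ v, (∃ j ∈ avail sx sy v, j ∈ J) → v ∈ S) :
    (⌈∑ j ∈ J, latentRate p j⌉₊ : ℕ∞) ≤ G.cutCap S := by
  obtain ⟨hX, hY, hXY⟩ := h
  simp only [rateLE_iff] at hX hY hXY
  obtain ⟨t, ht, htS⟩ := hT
  by_cases hsx : sx ∈ S <;> by_cases hsy : sy ∈ S
  · refine le_trans ?_ (hXY t ht S (by simp [Set.insert_subset_iff, hsx, hsy]) htS)
    refine Nat.cast_le.2 (Nat.ceil_mono ((Finset.sum_le_univ_sum_of_nonneg
      (latentRate_nonneg p)).trans_eq (sum_latent _)))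
  · have hJX : J = {.X'} := by
      refine hJ.subset_singleton_iff.1 fun j hj => ?_
      cases j
      · simp
      · exact (hsy (hS sy ⟨_, by simp [avail], hj⟩)).elim
      · exact (hsy (hS sy ⟨_, by simp [avail], hj⟩)).elim
    rw [hJX, Finset.sum_singleton]
    exact hX t ht S (by simpa using hsx) htS
  · have hJY : J = {.Y'} := by
      refine hJ.subset_singleton_iff.1 fun j hj => ?_
      cases j
      · exact (hsx (hS sx ⟨_, by simp [avail], hj⟩)).elim
      · simp
      · exact (hsx (hS sx ⟨_, by simp [avail], hj⟩)).elim
    rw [hJY, Finset.sum_singleton]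
    exact hY t ht S (by simpa using hsy) htS
  · obtain ⟨j, hj⟩ := hJ
    cases j
    · exact (hsx (hS sx ⟨_, by simp [avail], hj⟩)).elim
    · exact (hsy (hS sy ⟨_, by simp [avail], hj⟩)).elim
    · exact (hsx (hS sx ⟨_, by simp [avail], hj⟩)).elim

theorem exists_latentEdge_of_mem_avail (G : Network V E) {sx sy v : V} {j : Latent}
    (h : j ∈ avail sx sy v) :
    ∃ l : LatentEdge, (G.expand sx sy).src (.inr l) = .inr j ∧
      (G.expand sx sy).tgt (.inr l) = .inl v := by
  obtain ⟨rfl, rfl | rfl⟩ | ⟨rfl, rfl | rfl⟩ := h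
  exacts [⟨.X', rfl, rfl⟩, ⟨.KX, rfl, rfl⟩, ⟨.Y', rfl, rfl⟩, ⟨.KY, rfl, rfl⟩]

theorem cutCap_preimage_le [Fintype E] (sx sy : V) (S : Set (V ⊕ Latent)) :
    G.cutCap (Sum.inl ⁻¹' S) ≤ (G.expand sx sy).cutCap S := by
  rw [Network.cutCap, Network.cutCap, Finset.sum_filter, Finset.sum_filter,
    Fintype.sum_sum_type]
  exact le_self_add

theorem indepFeasible_expand {𝒳 𝒴 : Type*} [Fintype E] [Fintype 𝒳] [Fintype 𝒴] {sx sy : V}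
    {T : Finset V} {p : PMF (𝒳 × 𝒴)} (h : GKConditions G sx sy T p) :
    (G.expand sx sy).IndepFeasible Sum.inr (T.map Function.Embedding.inl) (latentRate p) := by
  intro J hJ
  rw [rateLE_iff]
  intro t' ht' S hJS htS
  obtain ⟨t, ht, rfl⟩ := Finset.mem_map.1 ht'
  by_cases hinf : ∃ l : LatentEdge, (G.expand sx sy).src (.inr l) ∈ S ∧
      (G.expand sx sy).tgt (.inr l) ∉ S
  · obtain ⟨l, hl⟩ := hinf
    have htop : (G.expand sx sy).cutCap S = ⊤ := top_le_iff.1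
      (Finset.single_le_sum (f := (G.expand sx sy).cap) (fun _ _ => zero_le)
        (Finset.mem_filter.2 ⟨Finset.mem_univ (Sum.inr l), hl⟩))
    rw [htop]
    exact le_top
  · refine (ceil_sum_latentRate_le_cutCap h hJ ⟨t, ht, htS⟩ ?_).trans (cutCap_preimage_le sx sy S)
    rintro v ⟨j, hjv, hj⟩
    obtain ⟨l, hl, hl'⟩ := exists_latentEdge_of_mem_avail G hjv
    by_contra hv
    refine hinf ⟨l, ?_, ?_⟩
    · rw [hl]
      exact hJS ⟨j, hj, rfl⟩
    · rw [hl']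
      exact hv

end Cuts

/-! ### Network codes on the expansion -/

section Expansion

/-- Strings of `k` bits, as numbers below `2 ^ k` and as vectors over `𝔽₂`. -/
noncomputable def bitsEquiv (k : ℕ) : Fin (2 ^ k) ≃ (Fin k → ZMod 2) :=
  Fintype.equivOfCardEq (by simp)

variable {V E : Type*} [Fintype V] [Fintype E] {G : Network V E}

/-- The latent edges carry entire messages to `sx` and `sy`, so that a network code for the
expansion is a network code for `G` with the messages `avail sx sy v` available at `v`. -/
theorem supports_expand {sx sy : V} {T : Finset V} {r : Latent → ℕ} {c : E → ℕ}
    (hG : G.Acyclic) (hc : ∀ e, G.cap e = c e)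
    (hcut : ∀ J : Finset Latent, J.Nonempty → (∀ j ∈ J, 0 < r j) → ∀ S : Set V,
      (∃ t ∈ T, t ∉ S) → (∀ v, (∃ j ∈ avail sx sy v, j ∈ J) → v ∈ S) →
      ∑ j ∈ J, r j + (Fintype.card V + Fintype.card Latent + 1) ≤
        ∑ e with G.src e ∈ S ∧ G.tgt e ∉ S, c e) :
    (G.expand sx sy).Supports Sum.inr (T.map Function.Embedding.inl) r := by
  obtain ⟨φ, hφ, hdec⟩ := exists_networkCode hG T hcut
  let bits : (∀ j, Fin (2 ^ r j)) → Msg r := fun m j => bitsEquiv (r j) (m j)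
  let ψ : E ⊕ LatentEdge → (∀ j, Fin (2 ^ r j)) → ℕ
    | .inl e, m => ((bitsEquiv (c e)).symm (φ (bits m) e)).1
    | .inr .X', m => (m .X').1
    | .inr .Y', m => (m .Y').1
    | .inr .KX, m => (m .K).1
    | .inr .KY, m => (m .K).1
  -- what a node of `G` sees in the expansion determines what it sees in the code for `G`
  have hview : ∀ v m m', (G.expand sx sy).SameView Sum.inr ψ (.inl v) m m' →
      (∀ j ∈ avail sx sy v, bits m j = bits m' j) ∧
        ∀ e, G.tgt e = v → φ (bits m) e = φ (bits m') e := by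
    intro v m m' h
    refine ⟨?_, fun e he => ?_⟩
    · rintro j (⟨rfl, rfl | rfl⟩ | ⟨rfl, rfl | rfl⟩)
      exacts [congrArg _ (Fin.ext (h.2 (.inr .X') rfl)), congrArg _ (Fin.ext (h.2 (.inr .KX) rfl)),
        congrArg _ (Fin.ext (h.2 (.inr .Y') rfl)), congrArg _ (Fin.ext (h.2 (.inr .KY) rfl))]
    · exact (bitsEquiv (c e)).symm.injective (Fin.ext (h.2 (.inl e) (congrArg Sum.inl he)))
  refine ⟨ψ, ?_, ?_, ?_⟩
  · rintro (e | l) m k hk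
    · have hck : c e = k := Nat.cast_injective (R := ℕ∞) ((hc e).symm.trans hk)
      rw [← hck]
      exact ((bitsEquiv (c e)).symm (φ (bits m) e)).2
    · exact (ENat.natCast_ne_top k hk.symm).elim
  · rintro (e | l) m m' h
    · obtain ⟨h1, h2⟩ := hview _ m m' h
      have := hφ e _ _ h1 h2
      simp only [ψ, this]
    · cases l
      exacts [congrArg Fin.val (h.1 .X' rfl), congrArg Fin.val (h.1 .Y' rfl),
        congrArg Fin.val (h.1 .K rfl), congrArg Fin.val (h.1 .K rfl)]
  · intro t' ht' m m' h
    obtain ⟨t, ht, rfl⟩ := Finset.mem_map.1 ht'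
    obtain ⟨h1, h2⟩ := hview t m m' h
    have := hdec t ht _ _ h1 h2
    exact funext fun j => (bitsEquiv (r j)).injective (congrFun this j)

end Expansion

/-! ### Feasibility by source decomposition -/

section Feasibility

variable {V E 𝒳 𝒴 : Type*} [Fintype E] [Fintype 𝒳] [Fintype 𝒴]
  {G : Network V E} {sx sy : V} {T : Finset V} {p : PMF (𝒳 × 𝒴)}

theorem gkConditions_iff_feasible
    (hK : entropy p (commonInfo p) = mutualInfo p Prod.fst Prod.snd) :
    GKConditions G sx sy T p ↔ Feasible G sx sy T p := by
  rw [GKConditions, Feasible, condEntropy_add_condEntropy_add_entropy hK,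
    condEntropy_fst_commonInfo_eq hK, condEntropy_snd_commonInfo_eq hK]

theorem feasibleByDecomposition [Fintype V] (hG : G.Acyclic) (hcap : ∀ e, G.cap e ≠ ⊤)
    (h : GKConditions G sx sy T p) : FeasibleByDecomposition G sx sy T p := by
  intro ε hε
  have hδ : 0 < ε / 6 := by positivity
  -- the number of bits that each cut has to spare
  set C := Fintype.card V + Fintype.card Latent + 1 with hC
  obtain ⟨n₀, hn₀⟩ := Filter.eventually_atTop.1 ((eventually_decompositionCode p hδ hε).and
    (Filter.eventually_ge_atTop ⌈2 * (C + 1) / ε⌉₊))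
  refine ⟨n₀, fun n hn => ?_⟩
  obtain ⟨hcode, hnC⟩ := hn₀ n hn
  have hnε : 2 * (C + 1 : ℝ) ≤ n * ε := (div_le_iff₀ hε).1 (Nat.ceil_le.1 hnC)
  have hr := fun j => codeLength_le (latentRate_nonneg p j) hδ.le n
  set N := ⌊(1 + ε) * n⌋₊ with hN
  refine ⟨N, fun j => codeLength (latentRate p j) (ε / 6) n, Nat.floor_le (by positivity),
    fun j => (hr j).trans ?_, hcode, ?_⟩
  · gcongr
    linarith
  refine supports_expand (c := fun e => N * (G.cap e).toNat) hG (fun e => ?_) ?_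
  · simp [Network.delayed, ENat.natCast_toNat (hcap e)]
  intro J hJ hpos S hT hS
  set κ := ∑ e with G.src e ∈ S ∧ G.tgt e ∉ S, (G.cap e).toNat with hκ
  have hrate : ∑ j ∈ J, latentRate p j ≤ κ := by
    have h1 := ceil_sum_latentRate_le_cutCap h hJ hT hS
    have h2 : G.cutCap S = κ := by
      rw [hκ, Network.cutCap, Nat.cast_sum]
      exact Finset.sum_congr rfl fun e _ => (ENat.natCast_toNat (hcap e)).symm
    rw [h2, Nat.cast_le] at h1
    exact Nat.ceil_le.1 h1
  -- some rate is positive, so the integer `κ` is at least `1`, and the excess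
  -- factor `1 + ε` of the delay gains at least about `ε * n` bits
  have hκ1 : (1 : ℝ) ≤ κ := by
    have h1 : 0 < ∑ j ∈ J, latentRate p j := by
      refine Finset.sum_pos (fun j hj => (latentRate_nonneg p j).lt_of_ne fun h0 => ?_) hJ
      have := hpos j hj
      simp [codeLength, ← h0] at this
    exact_mod_cast Nat.one_le_iff_ne_zero.2 fun h0 => (h1.trans_le hrate).ne' (by simp [h0])
  have hsum : (∑ j ∈ J, codeLength (latentRate p j) (ε / 6) n : ℝ) ≤ n * (κ + ε / 2) := by
    have hJ3 : (J.card : ℝ) ≤ 3 := by exact_mod_cast J.card_le_univ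
    refine (Finset.sum_le_sum fun j _ => hr j).trans ?_
    rw [← Finset.mul_sum, Finset.sum_add_distrib, Finset.sum_const, nsmul_eq_mul]
    gcongr
    nlinarith
  have hNlt := Nat.lt_floor_add_one ((1 + ε) * n)
  rw [← hN] at hNlt
  have hcutN : ∑ e with (G.delayed N).src e ∈ S ∧ (G.delayed N).tgt e ∉ S,
      N * (G.cap e).toNat = N * κ := by
    rw [hκ, Finset.mul_sum]
    rfl
  rw [hcutN]
  have hreal : (∑ j ∈ J, codeLength (latentRate p j) (ε / 6) n : ℝ) + C ≤ N * κ := by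
    nlinarith [mul_le_mul_of_nonneg_right hNlt.le (zero_le_one.trans hκ1),
      mul_nonneg (sub_nonneg.2 hκ1) (by linarith [Nat.cast_nonneg (α := ℝ) C] : 0 ≤ n * ε - 1)]
  exact_mod_cast hreal

end Feasibility

end GKSeparation

theorem mainTheorem6 {V E 𝒳 𝒴 : Type*} [Fintype V] [Fintype E] [Fintype 𝒳] [Fintype 𝒴]
    (G : GKSeparation.Network V E) (hG : G.Acyclic) (hcap : ∀ e, G.cap e ≠ ⊤)
    (sx sy : V) (hs : sx ≠ sy) (T : Finset V) (hsx : sx ∉ T) (hsy : sy ∉ T)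
    (p : PMF (𝒳 × 𝒴))
    (hK : GKSeparation.entropy p (GKSeparation.commonInfo p) =
      GKSeparation.mutualInfo p Prod.fst Prod.snd) :
    -- a feasible problem is feasible by source decomposition, and
    -- the expanded network meets the min-cut conditions for independent sources `X'`, `Y'`, `K`
    (GKSeparation.Feasible G sx sy T p →
      GKSeparation.FeasibleByDecomposition G sx sy T p ∧
      (G.expand sx sy).IndepFeasible Sum.inr (T.map Function.Embedding.inl)
        (GKSeparation.latentRate p)) ∧
    -- the two sets of conditions coincide, inequality by inequality
    (GKSeparation.GKConditions G sx sy T p ↔ GKSeparation.Feasible G sx sy T p) ∧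
    GKSeparation.condEntropy p Prod.fst (GKSeparation.commonInfo p) =
      GKSeparation.condEntropy p Prod.fst Prod.snd ∧
    GKSeparation.condEntropy p Prod.snd (GKSeparation.commonInfo p) =
      GKSeparation.condEntropy p Prod.snd Prod.fst ∧
    GKSeparation.condEntropy p Prod.fst (GKSeparation.commonInfo p) +
      GKSeparation.condEntropy p Prod.snd (GKSeparation.commonInfo p) +
      GKSeparation.entropy p (GKSeparation.commonInfo p) = GKSeparation.entropy p id := by
  have hiff := GKSeparation.gkConditions_iff_feasible (G := G) (sx := sx) (sy := sy) (T := T) hK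
  exact ⟨fun h => ⟨GKSeparation.feasibleByDecomposition hG hcap (hiff.2 h),
      GKSeparation.indepFeasible_expand (hiff.2 h)⟩, hiff,
    GKSeparation.condEntropy_fst_commonInfo_eq hK, GKSeparation.condEntropy_snd_commonInfo_eq hK,
    GKSeparation.condEntropy_add_condEntropy_add_entropy hK⟩
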